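/- **Theorem 2.2.** Let $t\ge 0$ and let $r_1,\dots,r_t\ge 0$ be integers. Let $F$ be the free group on $x_1,\dots,x_t$, let $H_i=\mathbb Z_{r_i}=\mathbb Z/r_i\mathbb Z$ (so $H_i=\mathbb Z$ if $r_i=0$), and let $S$ be the normal closure of $x_1^{r_1},\dots,x_t^{r_t}$ in $F$. Write $\gamma_m(F)$ for the terms of the lower central series ($\gamma_1(F)=F$, $\gamma_{m+1}(F)=[\gamma_m(F),F]$), and put $\rho_1(S)=S$, $\rho_{m+1}(S)=[\rho_m(S),F]$, so that $\rho_{m+1}(S)=[S,\,{}_mF]$. Basic commutators are the following bracketed words in the letters $x_1,\dots,x_t$, where the weight of a word is its number of letters. Fix a strict total order on bracketed words such that words of smaller weight come first and $x_i<x_j$ whenever $i<j$ (it is otherwise arbitrary within each weight). Each letter is basic; a word $[u,v]$ is basic if and only if $u$ and $v$ are basic, $u>v$, and moreover $b\le v$ whenever $u=[a,b]$. For a bracketed word $w$ define an abelian group $H_w$ and an element $\tau_w\in H_w$ recursively by $H_{x_i}=H_i$, $\tau_{x_i}=1\in\mathbb Z/r_i\mathbb Z$, and $H_{[u,v]}=H_u\otimes_{\mathbb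 Z}H_v$, $\tau_{[u,v]}=\tau_u\otimes\tau_v$. Let $$T(H_1,\dots,H_t)_{s}=\bigoplus_{w}H_w ,$$ the sum being over all basic commutators $w$ of weight $s$. Then, for every $c\ge 1$ and every such order, there is an isomorphism of groups $$\frac{\gamma_{c+1}(F)}{\rho_{c+1}(S)\,\gamma_{c+2}(F)}\;\cong\;T(H_1,\dots,H_t)_{c+1}$$ which, for each basic commutator $w$ of weight $c+1$, sends the class of the element of $F$ obtained by evaluating $w$ (which lies in $\gamma_{c+1}(F)$) to the elementary tensor $\tau_w$ in the summand $H_w$. -/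

import Mathlib

open scoped TensorProduct commutatorElement

namespace BasicComm

/-- `iterComm S n` is the left-normed commutator subgroup `[S, F, ..., F]` with `n` copies of the
whole group `F`. So `ρ_{m+1}(S) = [S, _m F]` is `iterComm S m`. -/
def iterComm {F : Type*} [Group F] (S : Subgroup F) : ℕ → Subgroup F
  | 0 => S
  | n + 1 => ⁅iterComm S n, (⊤ : Subgroup F)⁆

instance iterComm_normal {F : Type*} [Group F] (S : Subgroup F) [hS : S.Normal] (n : ℕ) :
    (iterComm S n).Normal := by
  induction n with
  | zero => exact hS
  | succ n ih =>
    have := ih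
    exact Subgroup.commutator_normal _ _

/-- The subgroup `S`: the normal closure in the free group on `x_1, ..., x_t` of the elements
`x_i ^ r_i`. -/
def powClosure {t : ℕ} (r : Fin t → ℕ) : Subgroup (FreeGroup (Fin t)) :=
  Subgroup.normalClosure (Set.range fun i => FreeGroup.of i ^ r i)

instance powClosure_normal {t : ℕ} (r : Fin t → ℕ) : (powClosure r).Normal :=
  Subgroup.normalClosure_normal

/-- The group `γ_{c+1}(F) / (ρ_{c+1}(S) γ_{c+2}(F))`. Mathlib's lower central series starts at
index `0`, so `γ_{c+1}(F)` is `(⊤ : Subgroup F).lowerCentralSeries c`. -/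
abbrev LCSQuotient {t : ℕ} (r : Fin t → ℕ) (c : ℕ) : Type :=
  ↥((⊤ : Subgroup (FreeGroup (Fin t))).lowerCentralSeries c) ⧸
    (iterComm (powClosure r) c ⊔
      (⊤ : Subgroup (FreeGroup (Fin t))).lowerCentralSeries (c + 1)).subgroupOf
        ((⊤ : Subgroup (FreeGroup (Fin t))).lowerCentralSeries c)

/-- The formal bracketed words on the letters `x_1, ..., x_t`; the product `u * v` stands for the
formal commutator `[u, v]`, and `FreeMagma.length` is the weight. -/
abbrev BracketWord (t : ℕ) : Type := FreeMagma (Fin t)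

/-- The orderings admitted in the definition of basic commutators: strict total orders in which
smaller weight comes first and `x_1 < ... < x_t`; the order within a given weight `≥ 2` is
arbitrary. -/
structure IsCommutatorOrder {t : ℕ} (lt : BracketWord t → BracketWord t → Prop) : Prop where
  irrefl : ∀ u, ¬ lt u u
  trans : ∀ u v w, lt u v → lt v w → lt u w
  total : ∀ u v, lt u v ∨ u = v ∨ lt v u
  weight : ∀ u v, u.length < v.length → lt u v
  letters : ∀ i j : Fin t, i < j → lt (FreeMagma.of i) (FreeMagma.of j)

/-- Orderings as above exist for every number of letters. -/
theorem exists_isCommutatorOrder (t : ℕ) :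
    ∃ lt : BracketWord t → BracketWord t → Prop, IsCommutatorOrder lt := by
  let f : BracketWord t → (ℕ ×ₗ ℕ) := fun u =>
    toLex (u.length, FreeMagma.recOnMul u (fun i => (i : ℕ)) (fun _ _ _ _ => 0))
  let s : BracketWord t → BracketWord t → Prop := WellOrderingRel
  refine ⟨fun u v => f u < f v ∨ f u = f v ∧ s u v, ?_, ?_, ?_, ?_, ?_⟩
  · rintro u (h | ⟨_, h⟩)
    · exact lt_irrefl _ h
    · exact irrefl_of s u h
  · rintro u v w (h | ⟨h, h'⟩) (k | ⟨k, k'⟩)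
    · exact Or.inl (h.trans k)
    · exact Or.inl (k ▸ h)
    · exact Or.inl (h ▸ k)
    · exact Or.inr ⟨h.trans k, trans_of s h' k'⟩
  · intro u v
    rcases lt_trichotomy (f u) (f v) with h | h | h
    · exact Or.inl (Or.inl h)
    · rcases trichotomous_of s u v with k | k | k
      · exact Or.inl (Or.inr ⟨h, k⟩)
      · exact Or.inr (Or.inl k)
      · exact Or.inr (Or.inr (Or.inr ⟨h.symm, k⟩))
    · exact Or.inr (Or.inr (Or.inl h))
  · intro u v h
    exact Or.inl (Prod.Lex.toLex_lt_toLex.mpr (Or.inl h))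
  · intro i j h
    exact Or.inl (Prod.Lex.toLex_lt_toLex.mpr (Or.inr ⟨rfl, h⟩))

/-- Basic commutators (P. Hall, M. Hall), as bracketed words: each letter is basic, and `[u, v]`
is basic iff `u`, `v` are basic, `u > v`, and `b ≤ v` whenever `u = [a, b]`. -/
def IsBasic {t : ℕ} (lt : BracketWord t → BracketWord t → Prop) : BracketWord t → Prop
  | .of _ => True
  | .mul u v => IsBasic lt u ∧ IsBasic lt v ∧ lt v u ∧
      ∀ a b : BracketWord t, u = a * b → b = v ∨ lt b v

/-- The element of the free group obtained by evaluating a bracketed word. -/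
def eval {t : ℕ} : BracketWord t → FreeGroup (Fin t)
  | .of i => FreeGroup.of i
  | .mul u v => ⁅eval u, eval v⁆

/-- The tensor product over `ℤ` of the groups `H_i = ℤ / r_i`, taken along a bracketed word:
`x_i` gives `H_i` and `[u, v]` gives the tensor product of the groups of `u` and `v`. -/
noncomputable def tensorGroup {t : ℕ} (r : Fin t → ℕ) : BracketWord t → ModuleCat.{0} ℤ
  | .of i => ModuleCat.of ℤ (ZMod (r i))
  | .mul u v => ModuleCat.of ℤ (tensorGroup r u ⊗[ℤ] tensorGroup r v)

/-- The elementary tensor of a bracketed word, whose entries are the generators `π_i x_i = 1` of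
`H_i = ℤ / r_i`. -/
noncomputable def elemTensor {t : ℕ} (r : Fin t → ℕ) : (w : BracketWord t) → tensorGroup r w
  | .of i => (1 : ZMod (r i))
  | .mul u v => elemTensor r u ⊗ₜ[ℤ] elemTensor r v

/-- The basic commutators of weight `s` on `t` letters. -/
abbrev BasicOfWeight {t : ℕ} (lt : BracketWord t → BracketWord t → Prop) (s : ℕ) : Type :=
  {w : BracketWord t // IsBasic lt w ∧ w.length = s}

/-- `T(H_1, ..., H_t)_s`: the direct sum, over all basic commutators of weight `s`, of the
corresponding tensor products. -/
abbrev T {t : ℕ} (r : Fin t → ℕ) (lt : BracketWord t → BracketWord t → Prop) (s : ℕ) : Type :=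
  DirectSum (BasicOfWeight lt s) fun w => tensorGroup r w.1

end BasicComm

/-!
Both groups are generated by elements indexed by the basic commutators `w` of weight `c + 1`, the
classes of the values of the `w` and the tensors `τ_w`, and the theorem holds because a `ℤ`-linear
combination of either family vanishes if and only if the coefficient of each `w` lies in the ideal
generated by the exponents `r i` of the letters of `w`. For the tensors this is right exactness.

* The classes generate by Hall's rewriting: the Hall–Witt identity is the Jacobi identity in the
  graded pieces, and it trades a commutator of basic commutators that is not itself basic for
  commutators of the same weight with larger entries.
* The relations hold because `[x, y] ^ n` agrees with `[x ^ n, y]` and `[x, y ^ n]` modulo higher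
  weight.
* There are no others. For an ideal `J` of `ℤ`, let `x_i ↦ 1 + a_i X` with `a_i` the `i`-th free
  generator of an associative algebra over `ℤ ⧸ J` if `r i ∈ J`, and `a_i = 0` otherwise. This
  Magnus homomorphism sends `x_i ^ r i` to `1` modulo `X ^ 2`, hence kills `ρ_{c+1}(S) γ_{c+2}(F)`
  modulo `X ^ (c + 2)`, and the leading coefficient of the image of `w` is the Lie bracket `w`
  evaluated at the `a_i`. Basic commutators are linearly independent in a free associative algebra
  over any ring, by Lazard elimination of one basic commutator at a time, so the choice of `J` as
  the ideal of `w` shows that the coefficient of `w` in a relation lies in `J`.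
-/

namespace BasicComm

section FreeAlgebra

variable {R : Type*} [CommRing R]

/-- The derivation of the free algebra that extends `d : X → FreeAlgebra R X`: the nilpotent part
of the algebra map `x ↦ x + d x ε` into the dual numbers. -/
noncomputable def liftDerivation {X : Type*} (d : X → FreeAlgebra R X) :
    FreeAlgebra R X →ₗ[R] FreeAlgebra R X :=
  (TrivSqZeroExt.sndHom (FreeAlgebra R X) (FreeAlgebra R X)).restrictScalars R ∘ₗ
    (FreeAlgebra.lift R (A := TrivSqZeroExt (FreeAlgebra R X) (FreeAlgebra R X))
      fun x => TrivSqZeroExt.inl (FreeAlgebra.ι R x) + TrivSqZeroExt.inr (d x)).toLinearMap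

theorem liftDerivation_ι_mul {X : Type*} (d : X → FreeAlgebra R X) (x : X)
    (a : FreeAlgebra R X) :
    liftDerivation d (FreeAlgebra.ι R x * a) =
      d x * a + FreeAlgebra.ι R x * liftDerivation d a := by
  let δ : FreeAlgebra R X →ₐ[R] TrivSqZeroExt (FreeAlgebra R X) (FreeAlgebra R X) :=
    FreeAlgebra.lift R fun x => TrivSqZeroExt.inl (FreeAlgebra.ι R x) + TrivSqZeroExt.inr (d x)
  have fst_δ : (TrivSqZeroExt.fstHom R _ _).comp δ = AlgHom.id R (FreeAlgebra R X) := by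
    ext
    simp [δ]
  have fst_δ_a : (δ a).fst = a := DFunLike.congr_fun fst_δ a
  change (δ (FreeAlgebra.ι R x * a)).snd = d x * a + FreeAlgebra.ι R x * (δ a).snd
  rw [map_mul, TrivSqZeroExt.snd_mul, fst_δ_a]
  simp [δ, add_comm]

variable {A : Type*} [Ring A] [Algebra R A]

theorem algHom_iterate_lie {B : Type*} [Ring B] [Algebra R B] (φ : A →ₐ[R] B) (a b : A) (n : ℕ) :
    φ ((fun x => ⁅x, b⁆)^[n] a) = (fun x => ⁅x, φ b⁆)^[n] (φ a) := by
  refine Function.Semiconj.iterate_right (fun x => ?_) n a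
  simp only [Ring.lie_def, map_sub, map_mul]

theorem lift_comp_injective {I J : Type*} {y : I → A}
    (hy : Function.Injective (FreeAlgebra.lift R y)) {g : J → I} (hg : Function.Injective g) :
    Function.Injective (FreeAlgebra.lift R (y ∘ g)) := by
  have hfactor : FreeAlgebra.lift R (y ∘ g) =
      (FreeAlgebra.lift R y).comp (FreeAlgebra.lift R (FreeAlgebra.ι R ∘ g)) := by
    ext
    simp
  have hleft : (FreeAlgebra.lift R (Function.extend g (FreeAlgebra.ι R) 0)).comp
      (FreeAlgebra.lift R (FreeAlgebra.ι R ∘ g)) = AlgHom.id R (FreeAlgebra R J) := by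
    ext
    simp [hg.extend_apply]
  rw [hfactor, AlgHom.coe_comp]
  exact hy.comp (Function.LeftInverse.injective (DFunLike.congr_fun hleft))

/-- The action of `FreeAlgebra R I` in which the letter `i₀` acts as minus the derivation
`(i, k) ↦ (i, k + 1)` and each other letter `i` as left multiplication by `(i, 0)`. -/
noncomputable def eliminationAction (R : Type*) [CommRing R] {I : Type*} [DecidableEq I] (i₀ : I) :
    FreeAlgebra R I →ₐ[R] Module.End R (FreeAlgebra R ({i // i ≠ i₀} × ℕ)) :=
  FreeAlgebra.lift R fun i =>
    if h : i = i₀ then -liftDerivation fun p => FreeAlgebra.ι R (p.1, p.2 + 1)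
    else LinearMap.mulLeft R (FreeAlgebra.ι R (⟨i, h⟩, 0))

theorem eliminationAction_iterate_lie {I : Type*} [DecidableEq I] {i₀ : I} (i : {i // i ≠ i₀})
    (k : ℕ) :
    eliminationAction R i₀ ((fun a => ⁅a, FreeAlgebra.ι R i₀⁆)^[k] (FreeAlgebra.ι R i.1)) =
      LinearMap.mulLeft R (FreeAlgebra.ι R (i, k)) := by
  induction k with
  | zero => simp [eliminationAction, i.2]
  | succ k ih =>
    rw [Function.iterate_succ_apply', Ring.lie_def, map_sub, map_mul, map_mul, ih]
    ext1 a
    simp [eliminationAction, Module.End.mul_apply, liftDerivation_ι_mul]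

/-- Lazard elimination of the letter `i₀`. -/
theorem lift_iterate_lie_injective {I : Type*} {y : I → A}
    (hy : Function.Injective (FreeAlgebra.lift R y)) (i₀ : I) :
    Function.Injective (FreeAlgebra.lift R
      fun p : {i // i ≠ i₀} × ℕ => (fun a => ⁅a, y i₀⁆)^[p.2] (y p.1)) := by
  classical
  let φ : FreeAlgebra R ({i // i ≠ i₀} × ℕ) →ₐ[R] FreeAlgebra R I :=
    FreeAlgebra.lift R fun p =>
      (fun a => ⁅a, FreeAlgebra.ι R i₀⁆)^[p.2] (FreeAlgebra.ι R p.1.1)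
  have hfactor : FreeAlgebra.lift R (fun p : {i // i ≠ i₀} × ℕ =>
      (fun a => ⁅a, y i₀⁆)^[p.2] (y p.1)) = (FreeAlgebra.lift R y).comp φ := by
    ext p
    simp [φ, algHom_iterate_lie]
  have hact : (eliminationAction R i₀).comp φ = Algebra.lmul R _ := by
    ext1
    funext p
    simp only [φ, Function.comp_apply, AlgHom.comp_apply, FreeAlgebra.lift_ι_apply,
      eliminationAction_iterate_lie]
    rfl
  rw [hfactor, AlgHom.coe_comp]
  refine hy.comp (Function.LeftInverse.injective (g := fun b => eliminationAction R i₀ b 1) ?_)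
  intro a
  have hact_a : eliminationAction R i₀ (φ a) = Algebra.lmul R _ a := DFunLike.congr_fun hact a
  simp [hact_a]

theorem linearIndependent_of_lift_injective {I : Type*} {y : I → A}
    (hy : Function.Injective (FreeAlgebra.lift R y)) : LinearIndependent R y := by
  have hι : LinearIndependent R (FreeAlgebra.ι R : I → FreeAlgebra R I) := by
    convert (FreeAlgebra.basisFreeMonoid R I).linearIndependent.comp _ FreeMonoid.of_injective
      using 1
    funext i
    simp [FreeAlgebra.basisFreeMonoid, FreeAlgebra.equivMonoidAlgebraFreeMonoid]
  rw [← FreeAlgebra.ι_comp_lift (R := R) y]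
  exact hι.map' (FreeAlgebra.lift R y).toLinearMap (LinearMap.ker_eq_bot.mpr hy)

end FreeAlgebra

section BracketWords

/-- The value of a bracketed word in a type with a bracket. -/
def lieEval {X L : Type*} [Bracket L L] (x : X → L) : FreeMagma X → L
  | .of i => x i
  | .mul u v => ⁅lieEval x u, lieEval x v⁆

theorem lieEval_iterate_mul {X L : Type*} [Bracket L L] (x : X → L) (c w : FreeMagma X) (k : ℕ) :
    lieEval x ((fun a => a * c)^[k] w) = (fun a => ⁅a, lieEval x c⁆)^[k] (lieEval x w) :=
  Function.Semiconj.iterate_right (f := lieEval x) (fun _ => rfl) k w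

theorem finite_length_le (X : Type*) [Finite X] (n : ℕ) :
    {w : FreeMagma X | w.length ≤ n}.Finite := by
  induction n with
  | zero => exact Set.finite_empty.subset fun w hw => (w.length_pos.not_ge hw).elim
  | succ n ih =>
    refine ((Set.finite_range FreeMagma.of).union (ih.image2 (· * ·) ih)).subset fun w hw => ?_
    cases w with
    | of i => exact Or.inl ⟨i, rfl⟩
    | mul u v =>
      have huv : u.length + v.length ≤ n + 1 := hw
      have hu := u.length_pos
      have hv := v.length_pos
      exact Or.inr ⟨u, Set.mem_ofPred.2 (by omega), v, Set.mem_ofPred.2 (by omega), rfl⟩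

theorem of_ne_mul {X : Type*} {u v : FreeMagma X} {i : X} : FreeMagma.of i ≠ u * v := by
  rintro ⟨⟩

theorem right_eq_of_mul_eq_mul {X : Type*} {a b c d : FreeMagma X} (h : a * b = c * d) :
    b = d := by
  cases h
  rfl

end BracketWords

section BasicCommutators

variable {t : ℕ} {lt : BracketWord t → BracketWord t → Prop}

theorem IsCommutatorOrder.isStrictTotalOrder (hlt : IsCommutatorOrder lt) :
    IsStrictTotalOrder (BracketWord t) lt where
  irrefl := hlt.irrefl
  trans := hlt.trans
  trichotomous u v huv hvu := ((hlt.total u v).resolve_left huv).resolve_right hvu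

theorem IsCommutatorOrder.lt_mul_right (hlt : IsCommutatorOrder lt) (u v : BracketWord t) :
    lt v (u * v) :=
  hlt.weight _ _ (Nat.lt_add_of_pos_left u.length_pos)

/-- Initial segments of the basic commutators. -/
def IsBasicInitial (lt : BracketWord t → BracketWord t → Prop) (E : Finset (BracketWord t)) :
    Prop :=
  ∀ v ∈ E, IsBasic lt v ∧ ∀ w, IsBasic lt w → lt w v → w ∈ E

theorem IsBasicInitial.mem_iff_lt (hlt : IsCommutatorOrder lt) {c : BracketWord t}
    {E : Finset (BracketWord t)} [DecidableEq (BracketWord t)]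
    (hE : IsBasicInitial lt (insert c E)) (hc : ∀ v ∈ E, lt v c) {w : BracketWord t}
    (hw : IsBasic lt w) : w ∈ E ↔ lt w c := by
  refine ⟨hc w, fun hwc => ?_⟩
  have hmem : w ∈ insert c E := (hE c (Finset.mem_insert_self c E)).2 w hw hwc
  exact Finset.mem_of_mem_insert_of_ne hmem fun h => hlt.irrefl c (h ▸ hwc)

theorem IsBasicInitial.of_insert (hlt : IsCommutatorOrder lt) {c : BracketWord t}
    {E : Finset (BracketWord t)} [DecidableEq (BracketWord t)]
    (hE : IsBasicInitial lt (insert c E)) (hc : ∀ v ∈ E, lt v c) : IsBasicInitial lt E :=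
  fun v hv => ⟨(hE v (Finset.mem_insert_of_mem hv)).1, fun w hw hwv =>
    (hE.mem_iff_lt hlt hc hw).2 (hlt.trans w v c hwv (hc v hv))⟩

/-- The basic commutators that are not in `E` but whose right factor, if any, is in `E`. When `E`
is an initial segment of the basic commutators, these are the free generators left after the
elements of `E` have been eliminated. -/
abbrev Remaining (lt : BracketWord t → BracketWord t → Prop) (E : Finset (BracketWord t)) : Type :=
  {w : BracketWord t // IsBasic lt w ∧ w ∉ E ∧ ∀ a b, w = a * b → b ∈ E}

theorem exists_remaining_iterate_mul (hlt : IsCommutatorOrder lt) {c : BracketWord t}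
    {E : Finset (BracketWord t)} (hE : ∀ {w}, IsBasic lt w → (w ∈ E ↔ lt w c))
    {w : BracketWord t} (hw : IsBasic lt w) (hwc : w ≠ c) (hwE : w ∉ E)
    (hright : ∀ a b, w = a * b → b ∈ E ∨ b = c) :
    ∃ (y : Remaining lt E) (k : ℕ), y.1 ≠ c ∧ w = (fun a => a * c)^[k] y.1 := by
  induction w with
  | of i => exact ⟨⟨.of i, hw, hwE, fun a b h => absurd h of_ne_mul⟩, 0, hwc, rfl⟩
  | mul a b iha _ =>
    rcases hright a b rfl with hb | rfl
    · refine ⟨⟨.mul a b, hw, hwE, fun a' b' h => ?_⟩, 0, hwc, rfl⟩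
      rwa [← right_eq_of_mul_eq_mul h]
    · obtain ⟨ha, _, hba, hfactor⟩ := hw
      have hab : a ≠ b := fun h => hlt.irrefl b (h ▸ hba)
      have haE : a ∉ E := fun h => hlt.irrefl b (hlt.trans _ _ _ hba ((hE ha).1 h))
      obtain ⟨y, k, hy, hk⟩ := iha ha hab haE fun p q hpq => by
        subst hpq
        exact (hfactor p q rfl).symm.imp_left (hE ha.2.1).2
      refine ⟨y, k + 1, hy, ?_⟩
      rw [Function.iterate_succ_apply', ← hk]
      rfl

variable {R A : Type*} [CommRing R] [Ring A] [Algebra R A] {x : Fin t → A}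

theorem lift_lieEval_remaining_empty_injective
    (hx : Function.Injective (FreeAlgebra.lift R x)) :
    Function.Injective (FreeAlgebra.lift R fun w : Remaining lt ∅ => lieEval x w.1) := by
  have hletter : ∀ w : Remaining lt ∅, ∃ i, w.1 = FreeMagma.of i := by
    rintro ⟨w, -, -, hright⟩
    cases w with
    | of i => exact ⟨i, rfl⟩
    | mul a b => exact absurd (hright a b rfl) (Finset.notMem_empty b)
  choose g hg using hletter
  have hg_inj : Function.Injective g := fun v w h => Subtype.ext (by rw [hg, hg, h])
  convert lift_comp_injective hx hg_inj using 4 with w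
  rw [hg w]
  rfl

theorem lift_lieEval_remaining_insert_injective [DecidableEq (BracketWord t)]
    (hlt : IsCommutatorOrder lt) {c : BracketWord t} {E : Finset (BracketWord t)}
    (hE : IsBasicInitial lt (insert c E)) (hc : ∀ v ∈ E, lt v c)
    (hx : Function.Injective (FreeAlgebra.lift R fun w : Remaining lt E => lieEval x w.1)) :
    Function.Injective
      (FreeAlgebra.lift R fun w : Remaining lt (insert c E) => lieEval x w.1) := by
  have hcb : IsBasic lt c := (hE c (Finset.mem_insert_self c E)).1
  let c' : Remaining lt E := ⟨c, hcb, fun h => hlt.irrefl c (hc c h), fun a b hab => by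
    subst hab
    exact (hE.mem_iff_lt hlt hc hcb.2.1).2 (hlt.lt_mul_right a b)⟩
  have hiterate : ∀ w : Remaining lt (insert c E), ∃ p : {y : Remaining lt E // y ≠ c'} × ℕ,
      w.1 = (fun a => a * c)^[p.2] p.1.1.1 := by
    rintro ⟨w, hw, hwE, hright⟩
    rw [Finset.mem_insert, not_or] at hwE
    obtain ⟨y, k, hy, hk⟩ := exists_remaining_iterate_mul hlt (hE.mem_iff_lt hlt hc) hw hwE.1
      hwE.2 fun a b hab => (Finset.mem_insert.1 (hright a b hab)).symm
    exact ⟨(⟨y, fun h => hy (congrArg Subtype.val h)⟩, k), hk⟩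
  choose g hg using hiterate
  have hg_inj : Function.Injective g := fun v w h => Subtype.ext (by rw [hg, hg, h])
  convert lift_comp_injective (lift_iterate_lie_injective hx c') hg_inj using 4 with w
  rw [hg w, lieEval_iterate_mul]
  rfl

theorem lift_lieEval_remaining_injective (hlt : IsCommutatorOrder lt)
    (hx : Function.Injective (FreeAlgebra.lift R x)) {E : Finset (BracketWord t)}
    (hE : IsBasicInitial lt E) :
    Function.Injective (FreeAlgebra.lift R fun w : Remaining lt E => lieEval x w.1) := by
  classical
  have := hlt.isStrictTotalOrder
  let : LinearOrder (BracketWord t) := linearOrderOfSTO lt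
  induction E using Finset.induction_on_max with
  | empty => exact lift_lieEval_remaining_empty_injective hx
  | insert c E hc ih =>
    exact lift_lieEval_remaining_insert_injective hlt hE hc (ih (hE.of_insert hlt hc))

theorem linearIndependent_lieEval (hlt : IsCommutatorOrder lt)
    (hx : Function.Injective (FreeAlgebra.lift R x)) (n : ℕ) :
    LinearIndependent R fun w : BasicOfWeight lt n => lieEval x w.1 := by
  have hfinite : {w : BracketWord t | IsBasic lt w ∧ w.length < n}.Finite :=
    (finite_length_le (Fin t) n).subset fun w hw => hw.2.le
  let E := hfinite.toFinset
  have mem_E {w : BracketWord t} : w ∈ E ↔ IsBasic lt w ∧ w.length < n := hfinite.mem_toFinset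
  have hE : IsBasicInitial lt E := fun v hv => by
    refine ⟨(mem_E.1 hv).1, fun w hw hwv => mem_E.2 ⟨hw, ?_⟩⟩
    by_contra! hn
    exact hlt.irrefl w (hlt.trans _ _ _ hwv (hlt.weight _ _ ((mem_E.1 hv).2.trans_le hn)))
  have hremaining (w : BasicOfWeight lt n) : w.1 ∉ E ∧ ∀ a b, w.1 = a * b → b ∈ E := by
    obtain ⟨w, hw, rfl⟩ := w
    refine ⟨fun h => (mem_E.1 h).2.ne rfl, fun a b hab => ?_⟩
    obtain rfl : w = a * b := hab
    exact mem_E.2 ⟨hw.2.1, Nat.lt_add_of_pos_left a.length_pos⟩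
  let g (w : BasicOfWeight lt n) : Remaining lt E := ⟨w.1, w.2.1, hremaining w⟩
  have hg : Function.Injective g := fun v w h => Subtype.ext (congrArg Subtype.val h :)
  exact (linearIndependent_of_lift_injective (lift_lieEval_remaining_injective hlt hx hE)).comp g hg

end BasicCommutators

section Magnus

open PowerSeries

variable {A : Type*} [Ring A]

theorem X_pow_dvd_mul_left {n : ℕ} {φ : A⟦X⟧} (ψ : A⟦X⟧) (h : X ^ n ∣ φ) : X ^ n ∣ ψ * φ := by
  obtain ⟨a, rfl⟩ := h
  exact ⟨ψ * a, by rw [← mul_assoc, ← mul_assoc, X_pow_mul]⟩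

/-- The units of `A⟦X⟧` that are congruent to `1` modulo `X ^ n`. -/
def congruenceUnits (A : Type*) [Ring A] (n : ℕ) : Subgroup A⟦X⟧ˣ where
  carrier := {u | X ^ n ∣ (u : A⟦X⟧) - 1}
  one_mem' := by simp
  mul_mem' {u v} hu hv := by
    have huv : (↑(u * v) : A⟦X⟧) - 1 = (u : A⟦X⟧) * (v - 1) + (u - 1) := by
      rw [Units.val_mul]
      noncomm_ring
    rw [Set.mem_ofPred, huv]
    exact dvd_add (X_pow_dvd_mul_left _ hv) hu
  inv_mem' {u} hu := by
    have hinv : (↑u⁻¹ : A⟦X⟧) - 1 = -(↑u⁻¹ * (u - 1)) := by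
      rw [mul_sub, Units.inv_mul]
      noncomm_ring
    rw [Set.mem_ofPred, hinv]
    exact (X_pow_dvd_mul_left _ hu).neg_right

theorem mem_congruenceUnits {n : ℕ} {u : A⟦X⟧ˣ} :
    u ∈ congruenceUnits A n ↔ X ^ n ∣ (u : A⟦X⟧) - 1 :=
  Iff.rfl

theorem congruenceUnits_zero : congruenceUnits A 0 = ⊤ :=
  eq_top_iff.2 fun u _ => mem_congruenceUnits.2 (by simp)

theorem mem_congruenceUnits_succ {n : ℕ} (hn : n ≠ 0) {u : A⟦X⟧ˣ} :
    u ∈ congruenceUnits A (n + 1) ↔ u ∈ congruenceUnits A n ∧ coeff n (u : A⟦X⟧) = 0 := by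
  simp only [mem_congruenceUnits, X_pow_dvd_iff, Nat.forall_lt_succ_right, map_sub, coeff_one,
    if_neg hn, sub_zero]

theorem commutator_sub_one_eq {m n : ℕ} {u v : A⟦X⟧ˣ} {a b : A⟦X⟧}
    (hu : (u : A⟦X⟧) - 1 = X ^ m * a) (hv : (v : A⟦X⟧) - 1 = X ^ n * b) :
    (↑⁅u, v⁆ : A⟦X⟧) - 1 = X ^ (m + n) * ((a * b - b * a) * (↑u⁻¹ : A⟦X⟧) * (↑v⁻¹ : A⟦X⟧)) := by
  have hinv : (v : A⟦X⟧) * u * (↑u⁻¹ : A⟦X⟧) * (↑v⁻¹ : A⟦X⟧) = 1 := by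
    rw [Units.mul_inv_cancel_right, Units.mul_inv]
  calc (↑⁅u, v⁆ : A⟦X⟧) - 1 = ((u : A⟦X⟧) * v - v * u) * ↑u⁻¹ * ↑v⁻¹ := by
        rw [sub_mul, sub_mul, hinv, commutatorElement_def, Units.val_mul, Units.val_mul,
          Units.val_mul]
    _ = (((u : A⟦X⟧) - 1) * (v - 1) - (v - 1) * (u - 1)) * ↑u⁻¹ * ↑v⁻¹ := by noncomm_ring
    _ = (X ^ m * (X ^ n * a) * b - X ^ n * (X ^ m * b) * a) * ↑u⁻¹ * ↑v⁻¹ := by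
        rw [hu, hv, X_pow_mul (n := n) (φ := a), X_pow_mul (n := m) (φ := b)]
        simp only [mul_assoc]
    _ = X ^ (m + n) * ((a * b - b * a) * ↑u⁻¹ * ↑v⁻¹) := by
        rw [← mul_assoc, ← mul_assoc, ← pow_add, ← pow_add, add_comm n m]
        noncomm_ring

theorem commutator_congruenceUnits_le (m n : ℕ) :
    ⁅congruenceUnits A m, congruenceUnits A n⁆ ≤ congruenceUnits A (m + n) := by
  rw [Subgroup.commutator_le]
  rintro u ⟨a, ha⟩ v ⟨b, hb⟩
  exact ⟨_, commutator_sub_one_eq ha hb⟩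

instance congruenceUnits_normal (n : ℕ) : (congruenceUnits A n).Normal := by
  rw [← Subgroup.commutator_top_right_le_iff, ← congruenceUnits_zero]
  exact commutator_congruenceUnits_le n 0

theorem coeff_of_sub_one_eq {n : ℕ} (hn : n ≠ 0) {u a : A⟦X⟧} (h : u - 1 = X ^ n * a) :
    coeff n u = constantCoeff a := by
  rw [sub_eq_iff_eq_add.1 h, map_add, coeff_one, if_neg hn, add_zero]
  simpa using coeff_X_pow_mul a n 0

theorem constantCoeff_eq_one {n : ℕ} (hn : n ≠ 0) {u : A⟦X⟧ˣ} (hu : u ∈ congruenceUnits A n) :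
    constantCoeff (u : A⟦X⟧) = 1 := by
  obtain ⟨a, ha⟩ := hu
  rw [sub_eq_iff_eq_add.1 ha]
  simp [hn]

theorem coeff_commutator {m n : ℕ} (hm : m ≠ 0) (hn : n ≠ 0) {u v : A⟦X⟧ˣ}
    (hu : u ∈ congruenceUnits A m) (hv : v ∈ congruenceUnits A n) :
    coeff (m + n) (↑⁅u, v⁆ : A⟦X⟧) = ⁅coeff m (u : A⟦X⟧), coeff n (v : A⟦X⟧)⁆ := by
  have hu' := constantCoeff_eq_one hm (inv_mem hu)
  have hv' := constantCoeff_eq_one hn (inv_mem hv)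
  obtain ⟨a, ha⟩ := hu
  obtain ⟨b, hb⟩ := hv
  rw [coeff_of_sub_one_eq (by omega) (commutator_sub_one_eq ha hb), coeff_of_sub_one_eq hm ha,
    coeff_of_sub_one_eq hn hb, map_mul, map_mul, hu', hv', map_sub, map_mul, map_mul, mul_one,
    mul_one, Ring.lie_def]

theorem coeff_mul_of_mem {n : ℕ} (hn : n ≠ 0) {u v : A⟦X⟧ˣ} (hu : u ∈ congruenceUnits A n)
    (hv : v ∈ congruenceUnits A n) :
    coeff n (↑(u * v) : A⟦X⟧) = coeff n (u : A⟦X⟧) + coeff n (v : A⟦X⟧) := by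
  have hv' := constantCoeff_eq_one hn hv
  obtain ⟨a, ha⟩ := hu
  obtain ⟨b, hb⟩ := hv
  have huv : (↑(u * v) : A⟦X⟧) - 1 = X ^ n * (a * (v : A⟦X⟧) + b) := by
    rw [mul_add, ← hb, ← mul_assoc, ← ha, Units.val_mul]
    noncomm_ring
  rw [coeff_of_sub_one_eq hn huv, coeff_of_sub_one_eq hn ha, coeff_of_sub_one_eq hn hb, map_add,
    map_mul, hv', mul_one]

/-- The leading coefficient, as a homomorphism on the units congruent to `1` modulo `X ^ n`. -/
noncomputable def leadingCoeffHom (A : Type*) [Ring A] (n : ℕ) (hn : n ≠ 0) :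
    congruenceUnits A n →* Multiplicative A :=
  MonoidHom.mk' (fun u => Multiplicative.ofAdd (coeff n ((u : A⟦X⟧ˣ) : A⟦X⟧)))
    fun u v => congrArg Multiplicative.ofAdd (coeff_mul_of_mem hn u.2 v.2)

theorem coeff_pow_of_mem {n : ℕ} (hn : n ≠ 0) {u : A⟦X⟧ˣ} (hu : u ∈ congruenceUnits A n)
    (k : ℕ) : coeff n (↑(u ^ k) : A⟦X⟧) = k • coeff n (u : A⟦X⟧) :=
  map_pow (leadingCoeffHom A n hn) ⟨u, hu⟩ k

/-- The unit `1 + a X` of `A⟦X⟧`. -/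
noncomputable def oneAddUnit (a : A) : A⟦X⟧ˣ where
  val := 1 + X * C a
  inv := invOfUnit (1 + X * C a) 1
  val_inv := mul_invOfUnit _ 1 (by simp)
  inv_val := invOfUnit_mul _ 1 (by simp)

theorem oneAddUnit_mem (a : A) : oneAddUnit a ∈ congruenceUnits A 1 :=
  ⟨C a, by simp [oneAddUnit]⟩

theorem coeff_one_oneAddUnit (a : A) : coeff 1 (oneAddUnit a : A⟦X⟧) = a := by
  simp [oneAddUnit, coeff_one]

theorem oneAddUnit_pow_mem {a : A} {n : ℕ} (h : n • a = 0) :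
    oneAddUnit a ^ n ∈ congruenceUnits A 2 := by
  refine (mem_congruenceUnits_succ one_ne_zero).2 ⟨pow_mem (oneAddUnit_mem a) n, ?_⟩
  rw [coeff_pow_of_mem one_ne_zero (oneAddUnit_mem a), coeff_one_oneAddUnit, h]

theorem iterComm_le_comap_congruenceUnits {F : Type*} [Group F] {φ : F →* A⟦X⟧ˣ}
    (hφ : ∀ g, φ g ∈ congruenceUnits A 1) {S : Subgroup F} {k : ℕ}
    (hS : S ≤ (congruenceUnits A k).comap φ) (n : ℕ) :
    iterComm S n ≤ (congruenceUnits A (k + n)).comap φ := by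
  induction n with
  | zero => exact hS
  | succ n ih =>
    refine Subgroup.commutator_le.2 fun x hx y _ => ?_
    rw [Subgroup.mem_comap, map_commutatorElement]
    exact commutator_congruenceUnits_le _ 1 (Subgroup.commutator_mem_commutator (ih hx) (hφ y))

/-- The Magnus homomorphism sending the letter `i` to `1 + a i * X`. -/
noncomputable def magnus {I : Type*} (a : I → A) : FreeGroup I →* A⟦X⟧ˣ :=
  FreeGroup.lift fun i => oneAddUnit (a i)

theorem magnus_of {I : Type*} (a : I → A) (i : I) : magnus a (.of i) = oneAddUnit (a i) :=
  FreeGroup.lift_apply_of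

theorem magnus_mem {I : Type*} (a : I → A) (g : FreeGroup I) :
    magnus a g ∈ congruenceUnits A 1 := by
  have hrange : (magnus a).range ≤ congruenceUnits A 1 := by
    refine FreeGroup.range_lift_le ?_
    rintro _ ⟨i, rfl⟩
    exact oneAddUnit_mem (a i)
  exact hrange ⟨g, rfl⟩

variable {t : ℕ}

theorem magnus_eval (a : Fin t → A) (w : BracketWord t) :
    magnus a (eval w) ∈ congruenceUnits A w.length ∧
      coeff w.length (magnus a (eval w) : A⟦X⟧) = lieEval a w := by
  induction w with
  | of i => exact ⟨magnus_mem a _, (magnus_of a i) ▸ coeff_one_oneAddUnit (a i)⟩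
  | mul u v hu hv =>
    have heval : magnus a (eval (u.mul v)) = ⁅magnus a (eval u), magnus a (eval v)⁆ :=
      map_commutatorElement (magnus a) _ _
    rw [heval]
    refine ⟨commutator_congruenceUnits_le _ _ (Subgroup.commutator_mem_commutator hu.1 hv.1), ?_⟩
    exact (coeff_commutator u.length_pos.ne' v.length_pos.ne' hu.1 hv.1).trans
      (congrArg₂ _ hu.2 hv.2)

theorem powClosure_le_comap_magnus {a : Fin t → A} {r : Fin t → ℕ} (h : ∀ i, r i • a i = 0) :
    powClosure r ≤ (congruenceUnits A 2).comap (magnus a) := by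
  refine Subgroup.normalClosure_le_normal ?_
  rintro _ ⟨i, rfl⟩
  rw [SetLike.mem_coe, Subgroup.mem_comap, map_pow, magnus_of]
  exact oneAddUnit_pow_mem (h i)

end Magnus

section CommutatorCalculus

variable {F : Type*} [Group F]

theorem commute_commutatorElement_of_rotate {x y z : F} (hx : Commute ⁅y, z⁆ x)
    (hy : Commute ⁅z, x⁆ y) (hyz_zx : Commute ⁅y, z⁆ ⁅z, x⁆) (hzx_xy : Commute ⁅z, x⁆ ⁅x, y⁆)
    (hxy_yz : Commute ⁅x, y⁆ ⁅y, z⁆) : Commute ⁅x, y⁆ z := by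
  have conj_eq (a b : F) : a * b * a⁻¹ = ⁅a, b⁆ * b := conj_eq_commutatorElement_mul
  have hall_witt : ⁅⁅x, y⁆, y * z * y⁻¹⁆ =
      (⁅⁅y, z⁆, z * x * z⁻¹⁆ * ⁅⁅z, x⁆, x * y * x⁻¹⁆)⁻¹ := by
    simp only [commutatorElement_def]
    group
  have hconj : Commute ⁅x, y⁆ (⁅y, z⁆ * z) := by
    rw [← commutatorElement_eq_one_iff_commute, ← conj_eq, hall_witt, conj_eq, conj_eq,
      (hyz_zx.mul_right hx).commutator_eq, (hzx_xy.mul_right hy).commutator_eq, mul_one, inv_one]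
  exact inv_mul_cancel_left ⁅y, z⁆ z ▸ hxy_yz.inv_right.mul_right hconj

theorem commutatorElement_zpow_left_of_commute {x y : F} (h : Commute x ⁅x, y⁆) (n : ℤ) :
    ⁅x ^ n, y⁆ = ⁅x, y⁆ ^ n := by
  have hmul : ⁅x, y⁆ = x * (y * x⁻¹ * y⁻¹) := by rw [commutatorElement_def]; group
  have hcomm : Commute x (y * x⁻¹ * y⁻¹) := by
    simpa [hmul] using (Commute.refl x).inv_right.mul_right h
  rw [hmul, hcomm.mul_zpow, conj_zpow, inv_zpow, commutatorElement_def]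
  simp only [mul_assoc]

theorem commutator_mem_symm {K : Subgroup F} {x y : F} : ⁅x, y⁆ ∈ K ↔ ⁅y, x⁆ ∈ K := by
  rw [← commutatorElement_inv, inv_mem_iff]

section Quotient

variable {K : Subgroup F} [K.Normal] {x y z : F}

theorem commute_mk_iff : Commute (x : F ⧸ K) (z : F ⧸ K) ↔ ⁅x, z⁆ ∈ K := by
  rw [← commutatorElement_eq_one_iff_commute, ← QuotientGroup.eq_one_iff]
  rfl

theorem commutator_zpow_mem {n : ℤ} (hx : ⁅x, ⁅x, y⁆⁆ ∈ K) (hn : ⁅x ^ n, y⁆ ∈ K) :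
    ⁅x, y⁆ ^ n ∈ K := by
  rw [← commute_mk_iff] at hx
  rw [← QuotientGroup.eq_one_iff] at hn ⊢
  exact (commutatorElement_zpow_left_of_commute (x := (x : F ⧸ K)) (y := y) hx n).symm.trans hn

/-- The elements that commute with `z` modulo the normal subgroup `K`. -/
def centralizerMod (K : Subgroup F) [K.Normal] (z : F) : Subgroup F :=
  (Subgroup.centralizer {(z : F ⧸ K)}).comap (QuotientGroup.mk' K)

theorem mem_centralizerMod : x ∈ centralizerMod K z ↔ ⁅x, z⁆ ∈ K := by
  rw [← commute_mk_iff, centralizerMod, Subgroup.mem_comap, Subgroup.mem_centralizer_singleton_iff]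
  rfl

end Quotient

theorem commutator_commutator_le_of_rotate {H₁ H₂ H₃ N : Subgroup F} [N.Normal]
    (h1 : ⁅⁅H₂, H₃⁆, H₁⁆ ≤ N) (h2 : ⁅⁅H₃, H₁⁆, H₂⁆ ≤ N) : ⁅⁅H₁, H₂⁆, H₃⁆ ≤ N := by
  have le_iff (K : Subgroup F) : K ≤ N ↔ K.map (QuotientGroup.mk' N) = ⊥ := by
    rw [Subgroup.map_eq_bot_iff, QuotientGroup.ker_mk']
  simp only [le_iff, Subgroup.map_commutator] at h1 h2 ⊢
  exact Subgroup.commutator_commutator_eq_bot_of_rotate h1 h2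

theorem commutator_iterComm_lowerCentralSeries_le (S : Subgroup F) [S.Normal] (m n : ℕ) :
    ⁅iterComm S m, (⊤ : Subgroup F).lowerCentralSeries n⁆ ≤ iterComm S (m + n + 1) := by
  induction n generalizing m with
  | zero => exact le_rfl
  | succ n ih =>
    rw [Subgroup.commutator_comm]
    refine commutator_commutator_le_of_rotate ?_ ?_
    · rw [Subgroup.commutator_comm ⊤, ← Nat.add_assoc, Nat.add_right_comm m n 1]
      exact ih (m + 1)
    · exact Subgroup.commutator_mono (ih m) le_rfl

theorem iterComm_top (n : ℕ) :
    iterComm (⊤ : Subgroup F) n = (⊤ : Subgroup F).lowerCentralSeries n := by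
  induction n with
  | zero => rfl
  | succ n ih => rw [iterComm, ih, Subgroup.lowerCentralSeries_succ]

/-- The lower central series `γ_n(F)` indexed from `1`, as in the paper; truncated subtraction
makes `γ_0(F) = F`. -/
def weightLCS (F : Type*) [Group F] (n : ℕ) : Subgroup F :=
  (⊤ : Subgroup F).lowerCentralSeries (n - 1)

instance weightLCS_normal (n : ℕ) : (weightLCS F n).Normal := by
  unfold weightLCS
  infer_instance

theorem weightLCS_antitone : Antitone (weightLCS F) :=
  fun _ _ h => Subgroup.lowerCentralSeries_antitone _ (Nat.sub_le_sub_right h 1)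

theorem commutator_mem_weightLCS {m n : ℕ} {x y : F} (hx : x ∈ weightLCS F m)
    (hy : y ∈ weightLCS F n) : ⁅x, y⁆ ∈ weightLCS F (m + n) := by
  suffices h : ⁅weightLCS F m, weightLCS F n⁆ ≤ weightLCS F (m + n) from
    h (Subgroup.commutator_mem_commutator hx hy)
  rcases m with _ | m
  · rw [Nat.zero_add]
    exact Subgroup.commutator_le_right _ _
  rcases n with _ | n
  · exact Subgroup.commutator_le_left _ _
  have h := commutator_iterComm_lowerCentralSeries_le (⊤ : Subgroup F) m n
  rw [iterComm_top, iterComm_top] at h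
  rwa [← Nat.add_assoc, Nat.add_right_comm m 1 n]

theorem normal_of_weightLCS_le {n : ℕ} {K : Subgroup F} (hle : weightLCS F (n + 1) ≤ K)
    (hge : K ≤ weightLCS F n) : K.Normal := by
  rw [← Subgroup.commutator_top_right_le_iff, Subgroup.commutator_le]
  exact fun x hx y _ => hle (commutator_mem_weightLCS (n := 1) (hge hx) (Subgroup.mem_top y))

/-- The Hall–Witt identity becomes the Jacobi identity in the graded pieces. -/
theorem commutator_commutator_mem_of_rotate {K : Subgroup F} [K.Normal] {k l m : ℕ} (hk : k ≠ 0)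
    (hl : l ≠ 0) (hm : m ≠ 0) (hK : weightLCS F (k + l + m + 1) ≤ K) {x y z : F}
    (hx : x ∈ weightLCS F k) (hy : y ∈ weightLCS F l) (hz : z ∈ weightLCS F m)
    (hyzx : ⁅⁅y, z⁆, x⁆ ∈ K) (hzxy : ⁅⁅z, x⁆, y⁆ ∈ K) : ⁅⁅x, y⁆, z⁆ ∈ K := by
  have hxy := commutator_mem_weightLCS hx hy
  have hyz := commutator_mem_weightLCS hy hz
  have hzx := commutator_mem_weightLCS hz hx
  have hyz_zx := hK (weightLCS_antitone (by omega) (commutator_mem_weightLCS hyz hzx))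
  have hzx_xy := hK (weightLCS_antitone (by omega) (commutator_mem_weightLCS hzx hxy))
  have hxy_yz := hK (weightLCS_antitone (by omega) (commutator_mem_weightLCS hxy hyz))
  rw [← commute_mk_iff] at hyzx hzxy hyz_zx hzx_xy hxy_yz ⊢
  exact commute_commutatorElement_of_rotate (x := (x : F ⧸ K)) (y := (y : F ⧸ K))
    (z := (z : F ⧸ K)) hyzx hzxy hyz_zx hzx_xy hxy_yz

/-- The subgroup `ρ_n(S) γ_{n+1}(F)`, for `1 ≤ n`. -/
def weightRel (S : Subgroup F) (n : ℕ) : Subgroup F :=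
  iterComm S (n - 1) ⊔ weightLCS F (n + 1)

instance weightRel_normal (S : Subgroup F) [S.Normal] (n : ℕ) : (weightRel S n).Normal :=
  Subgroup.sup_normal _ _

theorem commutator_mem_weightRel (S : Subgroup F) [S.Normal] {m k : ℕ} (hm : m ≠ 0) (hk : k ≠ 0)
    {x y : F} (hx : x ∈ weightRel S m) (hy : y ∈ weightLCS F k) :
    ⁅x, y⁆ ∈ weightRel S (m + k) := by
  suffices h : weightRel S m ≤ centralizerMod (weightRel S (m + k)) y from
    mem_centralizerMod.1 (h hx)
  refine sup_le (fun s hs => ?_) fun s hs => ?_ <;> rw [mem_centralizerMod]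
  · have hle := commutator_iterComm_lowerCentralSeries_le S (m - 1) (k - 1)
    rw [show m - 1 + (k - 1) + 1 = m + k - 1 by omega] at hle
    exact (le_sup_left : _ ≤ weightRel S (m + k))
      (hle (Subgroup.commutator_mem_commutator hs hy))
  · exact (le_sup_right : _ ≤ weightRel S (m + k))
      (weightLCS_antitone (by omega) (commutator_mem_weightLCS hs hy))

theorem commutator_zpow_mem_weightRel (S : Subgroup F) [S.Normal] {m k : ℕ} (hm : m ≠ 0)
    (hk : k ≠ 0) {x y : F} {n : ℤ} (hx : x ∈ weightLCS F m) (hy : y ∈ weightLCS F k)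
    (hn : x ^ n ∈ weightRel S m) : ⁅x, y⁆ ^ n ∈ weightRel S (m + k) :=
  commutator_zpow_mem
    ((le_sup_right : _ ≤ weightRel S (m + k)) (weightLCS_antitone (by omega)
      (commutator_mem_weightLCS hx (commutator_mem_weightLCS hx hy))))
    (commutator_mem_weightRel S hm hk hn hy)

end CommutatorCalculus

section HallRewriting

variable {t : ℕ}

theorem eval_mem_weightLCS (w : BracketWord t) : eval w ∈ weightLCS _ w.length := by
  induction w with
  | of i => exact Subgroup.mem_top _
  | mul u v hu hv => exact commutator_mem_weightLCS hu hv

/-- The ideal of `ℤ` generated by the exponents `r i` of the letters that occur in a word. It is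
the annihilator of the generator `elemTensor r w` of `tensorGroup r w`. -/
def wordIdeal (r : Fin t → ℕ) : BracketWord t → Ideal ℤ
  | .of i => Ideal.span {(r i : ℤ)}
  | .mul u v => wordIdeal r u ⊔ wordIdeal r v

theorem eval_zpow_mem {r : Fin t → ℕ} {w : BracketWord t} {n : ℤ} (hn : n ∈ wordIdeal r w) :
    eval w ^ n ∈ weightRel (powClosure r) w.length := by
  induction w generalizing n with
  | of i =>
    obtain ⟨k, rfl⟩ := Ideal.mem_span_singleton.1 hn
    rw [zpow_mul, zpow_natCast]
    exact zpow_mem ((le_sup_left : iterComm (powClosure r) 0 ≤ _)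
      (Subgroup.subset_normalClosure ⟨i, rfl⟩)) k
  | mul u v ihu ihv =>
    obtain ⟨p, hp, q, hq, rfl⟩ := Submodule.mem_sup.1 hn
    have hu := eval_mem_weightLCS u
    have hv := eval_mem_weightLCS v
    rw [zpow_add]
    refine mul_mem ?_ ?_
    · exact commutator_zpow_mem_weightRel _ u.length_pos.ne' v.length_pos.ne' hu hv (ihu hp)
    · have h := commutator_zpow_mem_weightRel _ v.length_pos.ne' u.length_pos.ne' hv hu (ihv hq)
      rw [← commutatorElement_inv, inv_zpow, inv_mem_iff, add_comm] at h
      exact h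

/-- The subgroup generated by the values of the basic commutators of weight `n`, together with the
lower central series term of weight `n + 1`. -/
def basicSubgroup (lt : BracketWord t → BracketWord t → Prop) (n : ℕ) :
    Subgroup (FreeGroup (Fin t)) :=
  Subgroup.closure (Set.range fun w : BasicOfWeight lt n => eval w.1) ⊔ weightLCS _ (n + 1)

variable {lt : BracketWord t → BracketWord t → Prop}

theorem weightLCS_le_basicSubgroup {m n : ℕ} (h : n < m) :
    weightLCS _ m ≤ basicSubgroup lt n :=
  (weightLCS_antitone h).trans le_sup_right

theorem basicSubgroup_le_weightLCS (n : ℕ) : basicSubgroup lt n ≤ weightLCS _ n := by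
  refine sup_le ((Subgroup.closure_le _).2 ?_) (weightLCS_antitone n.le_succ)
  rintro _ ⟨⟨w, _, rfl⟩, rfl⟩
  exact eval_mem_weightLCS w

instance basicSubgroup_normal (n : ℕ) : (basicSubgroup lt n).Normal :=
  normal_of_weightLCS_le le_sup_right (basicSubgroup_le_weightLCS n)

theorem eval_mem_basicSubgroup {w : BracketWord t} (hw : IsBasic lt w) :
    eval w ∈ basicSubgroup lt w.length :=
  (le_sup_left : _ ≤ basicSubgroup lt w.length) (Subgroup.subset_closure ⟨⟨w, hw, rfl⟩, rfl⟩)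

theorem commutator_mem_basicSubgroup {m n N : ℕ} (hN : m + n = N) {x z : FreeGroup (Fin t)}
    (hx : x ∈ basicSubgroup lt m) (hz : z ∈ weightLCS _ n)
    (h : ∀ w, IsBasic lt w → w.length = m → ⁅eval w, z⁆ ∈ basicSubgroup lt N) :
    ⁅x, z⁆ ∈ basicSubgroup lt N := by
  suffices hle : basicSubgroup lt m ≤ centralizerMod (basicSubgroup lt N) z from
    mem_centralizerMod.1 (hle hx)
  refine sup_le ((Subgroup.closure_le _).2 ?_) fun s hs => ?_
  · rintro _ ⟨⟨w, hw, hm⟩, rfl⟩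
    exact mem_centralizerMod.2 (h w hw hm)
  · exact mem_centralizerMod.2
      (weightLCS_le_basicSubgroup (by omega) (commutator_mem_weightLCS hs hz))

theorem exists_mul_of_not_isBasic_mul (hlt : IsCommutatorOrder lt) {u v : BracketWord t}
    (hu : IsBasic lt u) (hv : IsBasic lt v) (hvu : lt v u) (huv : ¬IsBasic lt (u * v)) :
    ∃ a b, u = a * b ∧ lt v b := by
  by_contra! hfactor
  exact huv ⟨hu, hv, hvu, fun a b hab =>
    ((or_assoc.2 (hlt.total b v)).resolve_right (hfactor a b hab)).symm⟩

theorem commutator_eval_mem_of_total (hlt : IsCommutatorOrder lt) {K : Subgroup (FreeGroup (Fin t))}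
    {u v : BracketWord t} (huv : lt v u → ⁅eval u, eval v⁆ ∈ K)
    (hvu : lt u v → ⁅eval v, eval u⁆ ∈ K) : ⁅eval u, eval v⁆ ∈ K := by
  rcases hlt.total u v with h | rfl | h
  · exact commutator_mem_symm.1 (hvu h)
  · exact commutatorElement_self (eval u) ▸ one_mem K
  · exact huv h

/-- If `u * v` is not basic, then `u = a * b` with `v < b < a`, and the Jacobi identity trades
`[[a, b], v]` for commutators `[p, q]` of the same weight whose entries exceed `v`. -/
theorem commutator_eval_mem_basicSubgroup_step (hlt : IsCommutatorOrder lt) {N : ℕ}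
    (hlow : ∀ p q, IsBasic lt p → IsBasic lt q → p.length + q.length < N →
      ⁅eval p, eval q⁆ ∈ basicSubgroup lt (p.length + q.length))
    {u v : BracketWord t} (hu : IsBasic lt u) (hv : IsBasic lt v) (hvu : lt v u)
    (hN : u.length + v.length = N)
    (hgt : ∀ p q, IsBasic lt p → IsBasic lt q → lt v p → lt v q → p.length + q.length = N →
      ⁅eval p, eval q⁆ ∈ basicSubgroup lt N) :
    ⁅eval u, eval v⁆ ∈ basicSubgroup lt N := by
  by_cases huv : IsBasic lt (u * v)
  · have h : ⁅eval u, eval v⁆ ∈ basicSubgroup lt (u.length + v.length) :=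
      eval_mem_basicSubgroup (w := u.mul v) huv
    rwa [hN] at h
  obtain ⟨a, b, rfl, hvb⟩ := exists_mul_of_not_isBasic_mul hlt hu hv hvu huv
  obtain ⟨ha, hb, hba, -⟩ := hu
  have hva : lt v a := hlt.trans _ _ _ hvb hba
  replace hN : a.length + b.length + v.length = N := hN
  have la := a.length_pos
  have lb := b.length_pos
  have lv := v.length_pos
  have hbva : ⁅⁅eval b, eval v⁆, eval a⁆ ∈ basicSubgroup lt N :=
    commutator_mem_basicSubgroup (by omega) (hlow b v hb hv (by omega)) (eval_mem_weightLCS a)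
      fun w hw hwl => hgt w a hw ha (hlt.weight _ _ (by omega)) hva (by omega)
  have hvab : ⁅⁅eval v, eval a⁆, eval b⁆ ∈ basicSubgroup lt N :=
    commutator_mem_basicSubgroup (by omega) (hlow v a hv ha (by omega)) (eval_mem_weightLCS b)
      fun w hw hwl => hgt w b hw hb (hlt.weight _ _ (by omega)) hvb (by omega)
  exact commutator_commutator_mem_of_rotate la.ne' lb.ne' lv.ne'
    (weightLCS_le_basicSubgroup (by omega)) (eval_mem_weightLCS a) (eval_mem_weightLCS b)
    (eval_mem_weightLCS v) hbva hvab

theorem commutator_eval_mem_basicSubgroup (hlt : IsCommutatorOrder lt) {u v : BracketWord t}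
    (hu : IsBasic lt u) (hv : IsBasic lt v) :
    ⁅eval u, eval v⁆ ∈ basicSubgroup lt (u.length + v.length) := by
  induction hN : u.length + v.length using Nat.strong_induction_on generalizing u v with
  | h N hlow =>
  have := hlt.isStrictTotalOrder
  have descent : ∀ v ∈ {w : BracketWord t | w.length ≤ N}, ∀ u, IsBasic lt u → IsBasic lt v →
      lt v u → u.length + v.length = N → ⁅eval u, eval v⁆ ∈ basicSubgroup lt N := by
    intro v hvN
    refine ((finite_length_le (Fin t) N).wellFoundedOn (r := Function.swap lt)).induction
      (P := fun v => ∀ u, IsBasic lt u → IsBasic lt v → lt v u → u.length + v.length = N →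
        ⁅eval u, eval v⁆ ∈ basicSubgroup lt N) hvN fun v _ ih u hu hv hvu hN => ?_
    refine commutator_eval_mem_basicSubgroup_step hlt
      (fun p q hp hq h => hlow _ h hp hq rfl) hu hv hvu hN fun p q hp hq hvp hvq hpq => ?_
    exact commutator_eval_mem_of_total hlt
      (fun h => ih q (Set.mem_ofPred.2 (by omega)) hvq p hp hq h hpq)
      fun h => ih p (Set.mem_ofPred.2 (by omega)) hvp q hq hp h (by omega)
  exact commutator_eval_mem_of_total hlt
    (fun h => descent v (Set.mem_ofPred.2 (by omega)) u hu hv h hN)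
    fun h => descent u (Set.mem_ofPred.2 (by omega)) v hv hu h (by omega)

theorem weightLCS_succ_eq_basicSubgroup (hlt : IsCommutatorOrder lt) (n : ℕ) :
    weightLCS _ (n + 1) = basicSubgroup lt (n + 1) := by
  have weight_one : ∀ g, g ∈ basicSubgroup lt 1 := by
    rw [← Subgroup.eq_top_iff', eq_top_iff, ← FreeGroup.closure_range_of]
    refine (Subgroup.closure_mono ?_).trans le_sup_left
    rintro _ ⟨i, rfl⟩
    exact ⟨⟨.of i, trivial, rfl⟩, rfl⟩
  refine le_antisymm ?_ (basicSubgroup_le_weightLCS _)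
  induction n with
  | zero => exact fun g _ => weight_one g
  | succ n ih =>
    refine Subgroup.commutator_le.2 fun x hx g _ => ?_
    refine commutator_mem_basicSubgroup (n := 1) rfl (ih hx) (Subgroup.mem_top g) fun w hw hwl => ?_
    rw [commutator_mem_symm]
    refine commutator_mem_basicSubgroup (by omega) (weight_one g) (eval_mem_weightLCS w)
      fun v hv hvl => ?_
    have h := commutator_eval_mem_basicSubgroup hlt hv hw
    rwa [hvl, hwl, add_comm] at h

end HallRewriting

section CyclicModules

variable {R M N : Type*} [CommRing R] [AddCommGroup M] [AddCommGroup N] [Module R M] [Module R N]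

open Submodule (span)

theorem linearCombination_surjective {ι : Type*} {x : ι → N} (hx : span R (Set.range x) = ⊤) :
    Function.Surjective (Finsupp.linearCombination R x) := by
  rw [← LinearMap.range_eq_top, Finsupp.range_linearCombination, hx]

theorem exists_linearEquiv_of_ker_eq {P : Type*} [AddCommGroup P] [Module R P] {f : P →ₗ[R] M}
    {g : P →ₗ[R] N} (hf : Function.Surjective f) (hg : Function.Surjective g)
    (h : LinearMap.ker f = LinearMap.ker g) : ∃ e : M ≃ₗ[R] N, ∀ p, e (f p) = g p := by
  refine ⟨(f.quotKerEquivOfSurjective hf).symm ≪≫ₗ Submodule.quotEquivOfEq _ _ h ≪≫ₗ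
    g.quotKerEquivOfSurjective hg, fun p => ?_⟩
  rw [LinearEquiv.trans_apply, LinearEquiv.trans_apply,
    LinearMap.quotKerEquivOfSurjective_symm_apply]
  rfl

theorem exists_linearMap_of_torsionOf_le {a : M} {b : N} (ha : span R {a} = ⊤)
    (h : Ideal.torsionOf R M a ≤ Ideal.torsionOf R N b) : ∃ f : M →ₗ[R] N, f a = b := by
  let f := LinearMap.toSpanSingleton R M a
  have hf : Function.Surjective f := by
    rw [← LinearMap.range_eq_top, ← LinearMap.span_singleton_eq_range, ha]
  refine ⟨(LinearMap.ker f).liftQ (LinearMap.toSpanSingleton R N b) h ∘ₗ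
    (f.quotKerEquivOfSurjective hf).symm.toLinearMap, ?_⟩
  have hsymm := f.quotKerEquivOfSurjective_symm_apply hf 1
  rw [LinearMap.toSpanSingleton_apply_one] at hsymm
  rw [LinearMap.comp_apply, LinearEquiv.coe_coe, hsymm]
  exact one_smul R b

theorem torsionOf_quotient_one (I : Ideal R) : Ideal.torsionOf R (R ⧸ I) 1 = I := by
  ext n
  rw [Ideal.mem_torsionOf_iff, ← Ideal.Quotient.eq_zero_iff_mem, Algebra.smul_def, mul_one]
  rfl

theorem span_singleton_tmul_eq_top {a : M} {b : N} (ha : span R {a} = ⊤) (hb : span R {b} = ⊤) :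
    span R {a ⊗ₜ[R] b} = ⊤ := by
  rw [← TensorProduct.map₂_mk_top_top_eq_top, ← ha, ← hb, Submodule.map₂_span_span,
    Set.image2_singleton]
  rfl

theorem torsionOf_tmul {a : M} {b : N} (ha : span R {a} = ⊤) (hb : span R {b} = ⊤) :
    Ideal.torsionOf R (M ⊗[R] N) (a ⊗ₜ b) = Ideal.torsionOf R M a ⊔ Ideal.torsionOf R N b := by
  set I := Ideal.torsionOf R M a ⊔ Ideal.torsionOf R N b
  refine le_antisymm (fun n hn => ?_) (sup_le (fun n hn => ?_) fun n hn => ?_)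
  · obtain ⟨f, hf⟩ := exists_linearMap_of_torsionOf_le (b := (1 : R ⧸ I)) ha
      (le_sup_left.trans_eq (torsionOf_quotient_one I).symm)
    obtain ⟨g, hg⟩ := exists_linearMap_of_torsionOf_le (b := (1 : R ⧸ I)) hb
      (le_sup_right.trans_eq (torsionOf_quotient_one I).symm)
    have h := congrArg (TensorProduct.lift ((LinearMap.mul R (R ⧸ I)).compl₁₂ f g)) hn
    rw [← torsionOf_quotient_one I, Ideal.mem_torsionOf_iff]
    simpa [hf, hg] using h
  · rw [Ideal.mem_torsionOf_iff] at hn ⊢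
    rw [TensorProduct.smul_tmul', hn, TensorProduct.zero_tmul]
  · rw [Ideal.mem_torsionOf_iff] at hn ⊢
    rw [← TensorProduct.tmul_smul, hn, TensorProduct.tmul_zero]

theorem linearCombination_lof_apply {ι : Type*} [DecidableEq ι] {M : ι → Type*}
    [∀ i, AddCommGroup (M i)] [∀ i, Module R (M i)] (a : ∀ i, M i) (l : ι →₀ R) (i : ι) :
    Finsupp.linearCombination R (fun i => DirectSum.lof R ι M i (a i)) l i = l i • a i := by
  induction l using Finsupp.induction_linear with
  | zero => simp
  | add l₁ l₂ h₁ h₂ => rw [map_add, DirectSum.add_apply, h₁, h₂, Finsupp.add_apply, add_smul]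
  | single j n =>
    rw [Finsupp.linearCombination_single, ← map_smul]
    obtain rfl | hij := eq_or_ne j i
    · rw [DirectSum.lof_apply, Finsupp.single_eq_same]
    · rw [Finsupp.single_eq_of_ne hij.symm, zero_smul]
      exact DirectSum.of_eq_of_ne _ _ _ hij.symm

theorem span_range_lof_eq_top {ι : Type*} [DecidableEq ι] {M : ι → Type*}
    [∀ i, AddCommGroup (M i)] [∀ i, Module R (M i)] {a : ∀ i, M i}
    (ha : ∀ i, span R {a i} = ⊤) :
    span R (Set.range fun i => DirectSum.lof R ι M i (a i)) = ⊤ := by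
  refine Submodule.eq_top_iff'.2 fun z => ?_
  induction z using DirectSum.induction_on with
  | zero => exact zero_mem _
  | add y z hy hz => exact add_mem hy hz
  | of i m =>
    obtain ⟨n, rfl⟩ := Submodule.mem_span_singleton.1 ((ha i).symm ▸ Submodule.mem_top : m ∈ _)
    have h := Submodule.smul_mem (span R (Set.range fun i => DirectSum.lof R ι M i (a i))) n
      (Submodule.subset_span ⟨i, rfl⟩)
    rwa [← map_smul] at h

theorem exists_linearEquiv_directSum {ι : Type*} [DecidableEq ι] {M : ι → Type*}
    [∀ i, AddCommGroup (M i)] [∀ i, Module R (M i)] {a : ∀ i, M i} {x : ι → N}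
    (ha : ∀ i, span R {a i} = ⊤) (hx : span R (Set.range x) = ⊤)
    (hrel : ∀ l : ι →₀ R, Finsupp.linearCombination R x l = 0 ↔
      ∀ i, l i ∈ Ideal.torsionOf R (M i) (a i)) :
    ∃ e : N ≃ₗ[R] DirectSum ι M, ∀ i, e (x i) = DirectSum.lof R ι M i (a i) := by
  obtain ⟨e, he⟩ := exists_linearEquiv_of_ker_eq (linearCombination_surjective hx)
    (linearCombination_surjective (span_range_lof_eq_top ha)) <| by
    ext l
    rw [LinearMap.mem_ker, LinearMap.mem_ker, hrel, DFunLike.ext_iff]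
    exact forall_congr' fun i => by
      rw [linearCombination_lof_apply, Ideal.mem_torsionOf_iff, DirectSum.zero_apply]
  exact ⟨e, fun i => by simpa using he (Finsupp.single i 1)⟩

end CyclicModules

section TensorGroup

variable {t : ℕ} (r : Fin t → ℕ)

theorem span_elemTensor (w : BracketWord t) : Submodule.span ℤ {elemTensor r w} = ⊤ := by
  induction w with
  | of i =>
    refine Submodule.eq_top_iff'.2 fun z => Submodule.mem_span_singleton.2 ?_
    obtain ⟨n, hn⟩ := ZMod.intCast_surjective (n := r i) z
    exact ⟨n, (zsmul_one (R := ZMod (r i)) n).trans hn⟩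
  | mul u v hu hv =>
    have h := span_singleton_tmul_eq_top hu hv
    -- `tensorGroup` carries the canonical `ℤ`-action rather than that of the tensor product.
    rw [Subsingleton.elim TensorProduct.instModule (AddCommGroup.toIntModule _)] at h
    exact h

theorem torsionOf_elemTensor (w : BracketWord t) :
    Ideal.torsionOf ℤ (tensorGroup r w) (elemTensor r w) = wordIdeal r w := by
  induction w with
  | of i =>
    ext n
    rw [wordIdeal, Ideal.mem_span_singleton, ← ZMod.intCast_zmod_eq_zero_iff_dvd,
      ← zsmul_one (R := ZMod (r i))]
    rfl
  | mul u v hu hv =>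
    rw [wordIdeal, ← hu, ← hv]
    have h := torsionOf_tmul (span_elemTensor r u) (span_elemTensor r v)
    rw [Subsingleton.elim TensorProduct.instModule (AddCommGroup.toIntModule _)] at h
    exact h

end TensorGroup

section LCSQuotient

variable {t : ℕ} {r : Fin t → ℕ} {c : ℕ} {lt : BracketWord t → BracketWord t → Prop}

theorem LCSQuotient.mul_comm (x y : LCSQuotient r c) : x * y = y * x := by
  obtain ⟨x, rfl⟩ := QuotientGroup.mk_surjective x
  obtain ⟨y, rfl⟩ := QuotientGroup.mk_surjective y
  refine commute_mk_iff.2 (Subgroup.mem_subgroupOf.2 (Subgroup.mem_sup_right ?_))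
  exact Subgroup.commutator_mono le_rfl le_top (Subgroup.commutator_mem_commutator x.2 y.2)

instance : CommGroup (LCSQuotient r c) where
  mul_comm := LCSQuotient.mul_comm

theorem eval_mem_lowerCentralSeries (w : BasicOfWeight lt (c + 1)) :
    eval w.1 ∈ (⊤ : Subgroup (FreeGroup (Fin t))).lowerCentralSeries c := by
  have h := eval_mem_weightLCS w.1
  rwa [w.2.2] at h

variable (r) in
/-- The class of the value of a basic commutator of weight `c + 1`, written additively. -/
def basicClass (w : BasicOfWeight lt (c + 1)) : Additive (LCSQuotient r c) :=
  .ofMul (QuotientGroup.mk ⟨eval w.1, eval_mem_lowerCentralSeries w⟩)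

theorem zsmul_basicClass {w : BasicOfWeight lt (c + 1)} {n : ℤ} (hn : n ∈ wordIdeal r w.1) :
    n • basicClass r w = 0 := by
  have h := eval_zpow_mem hn
  rw [w.2.2] at h
  exact (QuotientGroup.eq_one_iff (_ ^ n)).2 (Subgroup.mem_subgroupOf.2 h)

theorem span_basicClass (hlt : IsCommutatorOrder lt) :
    Submodule.span ℤ (Set.range (basicClass r : BasicOfWeight lt (c + 1) → _)) = ⊤ := by
  let P := Submodule.span ℤ (Set.range (basicClass r : BasicOfWeight lt (c + 1) → _))
  let K := (AddSubgroup.toSubgroup' P.toAddSubgroup).comap (QuotientGroup.mk' _)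
  have hgen : weightLCS _ (c + 1) ≤ K.map (Subgroup.subtype _) := by
    rw [weightLCS_succ_eq_basicSubgroup hlt]
    refine sup_le ((Subgroup.closure_le _).2 ?_) fun y hy => ?_
    · rintro _ ⟨w, rfl⟩
      exact ⟨⟨eval w.1, eval_mem_lowerCentralSeries w⟩, Submodule.subset_span ⟨w, rfl⟩, rfl⟩
    · refine ⟨⟨y, Subgroup.lowerCentralSeries_antitone _ c.le_succ hy⟩, ?_, rfl⟩
      rw [SetLike.mem_coe, Subgroup.mem_comap, QuotientGroup.mk'_apply,
        (QuotientGroup.eq_one_iff _).2 (Subgroup.mem_subgroupOf.2 (Subgroup.mem_sup_right hy))]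
      exact one_mem _
  refine Submodule.eq_top_iff'.2 fun x => ?_
  obtain ⟨⟨x, hx⟩, rfl⟩ := QuotientGroup.mk_surjective x.toMul
  obtain ⟨y, hy, rfl⟩ := hgen hx
  exact hy

theorem exists_leadingTermHom {A : Type*} [Ring A] {a : Fin t → A} (h : ∀ i, r i • a i = 0) :
    ∃ f : Additive (LCSQuotient r c) →+ A, ∀ w : BasicOfWeight lt (c + 1),
      f (basicClass r w) = lieEval a w.1 := by
  have hS : powClosure r ≤ (congruenceUnits A 2).comap (magnus a) := powClosure_le_comap_magnus h
  have hlcs (n : ℕ) : (⊤ : Subgroup (FreeGroup (Fin t))).lowerCentralSeries n ≤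
      (congruenceUnits A (n + 1)).comap (magnus a) := by
    rw [← iterComm_top, add_comm]
    exact iterComm_le_comap_congruenceUnits (magnus_mem a) (fun g _ => magnus_mem a g) n
  have hrel : iterComm (powClosure r) c ⊔
      (⊤ : Subgroup (FreeGroup (Fin t))).lowerCentralSeries (c + 1) ≤
        (congruenceUnits A (c + 2)).comap (magnus a) := by
    refine sup_le ?_ (hlcs (c + 1))
    rw [add_comm c 2]
    exact iterComm_le_comap_congruenceUnits (magnus_mem a) hS c
  let m : (⊤ : Subgroup (FreeGroup (Fin t))).lowerCentralSeries c →* congruenceUnits A (c + 1) :=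
    ((magnus a).comp (Subgroup.subtype _)).codRestrict _ fun x => hlcs c x.2
  let f : LCSQuotient r c →* Multiplicative A :=
    QuotientGroup.lift _ ((leadingCoeffHom A (c + 1) c.succ_ne_zero).comp m) fun x hx =>
      congrArg Multiplicative.ofAdd
        ((mem_congruenceUnits_succ c.succ_ne_zero).1 (hrel (Subgroup.mem_subgroupOf.1 hx))).2
  refine ⟨MonoidHom.toAdditiveLeft f, fun w => ?_⟩
  have h := (magnus_eval a w.1).2
  rw [w.2.2] at h
  exact h

open Classical in
theorem lieEval_ite {A : Type*} [Ring A] (a : Fin t → A) (J : Ideal ℤ) (w : BracketWord t) :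
    lieEval (fun i => if (r i : ℤ) ∈ J then a i else 0) w =
      if wordIdeal r w ≤ J then lieEval a w else 0 := by
  induction w with
  | of i => simp only [lieEval, wordIdeal, Ideal.span_singleton_le_iff_mem]
  | mul u v hu hv =>
    simp only [lieEval, wordIdeal, hu, hv, sup_le_iff, ite_and]
    split_ifs <;> simp [Ring.lie_def]

theorem mem_wordIdeal_of_linearCombination_eq_zero (hlt : IsCommutatorOrder lt)
    {l : BasicOfWeight lt (c + 1) →₀ ℤ} (hl : Finsupp.linearCombination ℤ (basicClass r) l = 0)
    (w₀ : BasicOfWeight lt (c + 1)) : l w₀ ∈ wordIdeal r w₀.1 := by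
  classical
  set J := wordIdeal r w₀.1
  let ι := FreeAlgebra.ι (ℤ ⧸ J) (X := Fin t)
  have hι : Function.Injective (FreeAlgebra.lift (ℤ ⧸ J) ι) := by
    rw [show FreeAlgebra.lift (ℤ ⧸ J) ι = AlgHom.id _ _ from
      FreeAlgebra.lift_comp_ι (AlgHom.id _ _)]
    exact Function.injective_id
  have hkill (i : Fin t) : r i • (if (r i : ℤ) ∈ J then ι i else 0) = 0 := by
    split_ifs with hi
    · rw [← Nat.cast_smul_eq_nsmul (ℤ ⧸ J), ← Int.cast_natCast,
        ← eq_intCast (Ideal.Quotient.mk J), Ideal.Quotient.eq_zero_iff_mem.2 hi, zero_smul]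
    · exact smul_zero _
  obtain ⟨f, hf⟩ := exists_leadingTermHom (c := c) (lt := lt) hkill
  have hsum : ∑ w ∈ l.support, (Ideal.Quotient.mk J (l w) * if wordIdeal r w.1 ≤ J then 1 else 0) •
      lieEval ι w.1 = 0 := by
    have h := congrArg f hl
    rw [Finsupp.linearCombination_apply, Finsupp.sum, map_sum, map_zero] at h
    rw [← h]
    refine Finset.sum_congr rfl fun w _ => ?_
    rw [map_zsmul, hf, lieEval_ite, ← smul_smul, ite_smul, one_smul, zero_smul, eq_intCast,
      Int.cast_smul_eq_zsmul]
  by_contra hmem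
  have hsupp : w₀ ∈ l.support := Finsupp.mem_support_iff.2 fun h => hmem (h ▸ J.zero_mem)
  have h := linearIndependent_iff'.1 (linearIndependent_lieEval hlt hι (c + 1)) _ _ hsum w₀ hsupp
  rw [if_pos le_rfl, mul_one] at h
  exact hmem (Ideal.Quotient.eq_zero_iff_mem.1 h)

theorem linearCombination_basicClass_eq_zero_iff (hlt : IsCommutatorOrder lt)
    (l : BasicOfWeight lt (c + 1) →₀ ℤ) :
    Finsupp.linearCombination ℤ (basicClass r) l = 0 ↔ ∀ w, l w ∈ wordIdeal r w.1 :=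
  ⟨mem_wordIdeal_of_linearCombination_eq_zero hlt,
    fun h => Finset.sum_eq_zero fun w _ => zsmul_basicClass (h w)⟩

end LCSQuotient

end BasicComm

theorem theorem2p2 (t : ℕ) (r : Fin t → ℕ) (c : ℕ) (hc : 1 ≤ c)
    (lt : BasicComm.BracketWord t → BasicComm.BracketWord t → Prop)
    (hlt : BasicComm.IsCommutatorOrder lt) :
    ∃ e : BasicComm.LCSQuotient r c ≃* Multiplicative (BasicComm.T r lt (c + 1)),
      ∀ w : BasicComm.BasicOfWeight lt (c + 1),
        ∃ hw : BasicComm.eval w.1 ∈ (⊤ : Subgroup (FreeGroup (Fin t))).lowerCentralSeries c,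
          e (QuotientGroup.mk ⟨BasicComm.eval w.1, hw⟩) =
            Multiplicative.ofAdd
              (DirectSum.of (fun w : BasicComm.BasicOfWeight lt (c + 1) =>
                (BasicComm.tensorGroup r w.1 : Type)) w (BasicComm.elemTensor r w.1)) := by
  have hrel (l : BasicComm.BasicOfWeight lt (c + 1) →₀ ℤ) :
      Finsupp.linearCombination ℤ (BasicComm.basicClass r) l = 0 ↔
        ∀ w, l w ∈
          Ideal.torsionOf ℤ (BasicComm.tensorGroup r w.1) (BasicComm.elemTensor r w.1) := by
    simp only [BasicComm.linearCombination_basicClass_eq_zero_iff hlt,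
      BasicComm.torsionOf_elemTensor]
  obtain ⟨e, he⟩ := BasicComm.exists_linearEquiv_directSum
    (fun w => BasicComm.span_elemTensor r w.1) (BasicComm.span_basicClass hlt) hrel
  refine ⟨AddEquiv.toMultiplicativeRight { e with }, fun w => ?_⟩
  exact ⟨BasicComm.eval_mem_lowerCentralSeries w, congrArg Multiplicative.ofAdd (he w)⟩
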